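/- Let $S=S_{1/3}\subset[0,1]^2$ be the Sierpiński carpet, obtained from $[0,1]^2$ by dividing it into nine squares of side $\frac13$, removing the open middle square, and repeating this in each of the remaining eight squares, and so on. Equip $S$ with the Euclidean metric and with $\mu=\mathcal H^{s}/\mathcal H^{s}(S)$, where $\mathcal H^s$ is the Hausdorff measure on $S$ of dimension $s=\frac{\log 8}{\log 3}$. **Definitions.** "Measurable" refers to the completion of $\mu$. A *quasi-Banach function lattice* $X$ is given by a functional $\|\cdot\|_X$ with values in $[0,\infty]$ on the measurable functions $S\to[-\infty,\infty]$, such that $\|u\|_X=0$ iff $u=0$ a.e., $\|au\|_X=|a|\|u\|_X$ for $a\in\mathbb R$, $\|u+v\|_X\le c(\|u\|_X+\|v\|_X)$ for a constant $c\ge1$, $\|u\|_X\le\|v\|_X$ if $|u|\le|v|$ a.e., and $\|\sum_{n\ge1}u_n\|_X\le\sum_{n\ge1}c^n\|u_n\|_X$ for $u_n\ge0$; then $X=\{u \text{ measurable}:\|u\|_X<\infty\}$, a set of functions defined everywhere. Nonconstant rectifiable curves $\gamma:[0,l_\gamma]\to S$, $l_\gamma>0$, are parametrized by arc length. There are *$X$-almost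 no nonconstant rectifiable curves* if there is a Borel function $\rho:S\to[0,\infty]$ in $X$ with $\int_\gamma\rho\,ds=\infty$ for every nonconstant rectifiable curve $\gamma$ in $S$. A Borel function $g:S\to[0,\infty]$ is an *upper gradient* of $u:S\to[-\infty,\infty]$ if $|u(\gamma(0))-u(\gamma(l_\gamma))|\le\int_\gamma g\,ds$ for all such $\gamma$, where $|(\pm\infty)-(\pm\infty)|=\infty$. Put $\|u\|_{N^1X}=\|u\|_X+\inf_g\|g\|_X$, the infimum over all upper gradients $g$ of $u$, and $N^1X=\{u\in X:\|u\|_{N^1X}<\infty\}$. The *capacity* of $E\subset S$ is $C_X(E)=\inf\{\|u\|_{N^1X}:u\in N^1X,\ u\ge1\text{ on }E\}$. A function $u:S\to[-\infty,\infty]$ is *weakly quasicontinuous* if for every $\varepsilon>0$ there is $E\subset S$ with $C_X(E)<\varepsilon$ such that $u|_{S\setminus E}$ is real-valued and continuous, and *quasicontinuous* if $E$ can always be chosen open. The capacity is *$c$-quasiouter* if $\inf\{C_X(G):G\supset E \text{ open}\}\le c\,C_X(E)$ for all $E\subset S$. Consider the properties (A) every $u\in N^1X$ is quasicontinuous; (B)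 $C_X$ is an outer capacity, i.e. $1$-quasiouter; (C) $C_X$ is a quasiouter capacity, i.e. $c$-quasiouter for some $c\ge1$; (D) every weakly quasicontinuous $u:S\to[-\infty,\infty]$ is quasicontinuous; (E) if $C_X(E)=0$ and $\varepsilon>0$, there is an open $G\supset E$ with $C_X(G)<\varepsilon$; (F) for every $u\in N^1X$ there is a quasicontinuous $v$ with $C_X(\{v\ne u\})=0$; (G) every $u\in N^1X$ is weakly quasicontinuous. **Statement.** 1. $\mu$ is a probability measure, and every open ball in $S$ (of positive radius, centred in $S$) has positive measure. 2. The pushforward of $\mu$ under $(x_1,x_2)\mapsto x_1$ and the Lebesgue measure on $[0,1]$ are mutually singular. 3. For every quasi-Banach function lattice $X$ over $(S,\mu)$ there are $X$-almost no nonconstant rectifiable curves in $S$, and $N^1X=X$ with $\|u\|_{N^1X}=\|u\|_X$ for all $u\in X$. 4. For $X=L^\infty(S,\mu)$ each of the properties (A)–(G) fails. Moreover, there is a compact set $K\subset S$ with empty interior and $\mu(K)>0$ such that $\chi_K\in N^1L^\infty$ is not weakly quasicontinuous. -/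

import Mathlib

open Set MeasureTheory Filter
open scoped ENNReal NNReal

noncomputable section

namespace Newtonian

/-! ## Quasi-Banach function lattices -/

/-- A quasi-Banach function lattice over `(P, μ)`, given by its quasinorm on extended real-valued
functions that are defined everywhere. Measurability is with respect to the completion of `μ`,
i.e. `AEMeasurable`; values of `norm` on other functions play no role. The Riesz-Fischer property
is stated for functions with values in `[0, ∞]`; by the lattice property this is the same as for
functions that are nonnegative almost everywhere. -/
structure QuasiBanachFunctionLattice {P : Type*} [MeasurableSpace P] (μ : Measure P) where
  norm : (P → EReal) → ℝ≥0∞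
  /-- the modulus of concavity -/
  c : ℝ≥0
  one_le_c : 1 ≤ c
  norm_eq_zero_iff : ∀ u : P → EReal, AEMeasurable u μ → (norm u = 0 ↔ u =ᵐ[μ] 0)
  norm_smul : ∀ (a : ℝ) (u : P → EReal), AEMeasurable u μ →
    norm (fun x => (a : EReal) * u x) = ENNReal.ofReal |a| * norm u
  norm_add_le : ∀ u v : P → EReal, AEMeasurable u μ → AEMeasurable v μ →
    norm (fun x => u x + v x) ≤ c * (norm u + norm v)
  norm_mono : ∀ u v : P → EReal, AEMeasurable u μ → AEMeasurable v μ →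
    (∀ᵐ x ∂μ, (u x).abs ≤ (v x).abs) → norm u ≤ norm v
  riesz_fischer : ∀ u : ℕ → P → ℝ≥0∞, (∀ n, AEMeasurable (u n) μ) →
    norm (fun x => ((∑' n, u n x : ℝ≥0∞) : EReal)) ≤
      ∑' n, (c : ℝ≥0∞) ^ (n + 1) * norm (fun x => (u n x : EReal))

theorem abs_coe_ennreal (x : ℝ≥0∞) : (x : EReal).abs = x := by
  induction x with
  | top => simp
  | coe x =>
    change (((x : ℝ) : EReal)).abs = _
    rw [EReal.abs_def, abs_of_nonneg (NNReal.coe_nonneg x), ENNReal.ofReal_coe_nnreal]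

theorem abs_add_le (x y : EReal) : (x + y).abs ≤ x.abs + y.abs := by
  induction x with
  | bot => simp
  | top => simp
  | coe x =>
    induction y with
    | bot => simp
    | top => simp
    | coe y =>
      rw [← EReal.coe_add, EReal.abs_def, EReal.abs_def, EReal.abs_def,
        ← ENNReal.ofReal_add (abs_nonneg x) (abs_nonneg y)]
      exact ENNReal.ofReal_le_ofReal (_root_.abs_add_le x y)

/-- The lattice `L^∞(P, μ)`, normed by the essential supremum of `|u|`. -/
def LInfty {P : Type*} [MeasurableSpace P] (μ : Measure P) : QuasiBanachFunctionLattice μ where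
  norm u := essSup (fun x => (u x).abs) μ
  c := 1
  one_le_c := le_rfl
  norm_eq_zero_iff u _ := by
    rw [ENNReal.essSup_eq_zero_iff]
    simp only [EventuallyEq, Pi.zero_apply, EReal.abs_eq_zero_iff]
  norm_smul a u _ := by
    simp only [EReal.abs_mul, EReal.abs_def]
    exact ENNReal.essSup_const_mul
  norm_add_le u v _ _ := by
    rw [ENNReal.coe_one, one_mul]
    exact (essSup_mono_ae (Eventually.of_forall fun x => abs_add_le (u x) (v x))).trans
      (ENNReal.essSup_add_le _ _)
  norm_mono u v _ _ h := essSup_mono_ae h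
  riesz_fischer u _ := by
    simp only [ENNReal.coe_one, one_pow, one_mul, abs_coe_ennreal]
    refine essSup_le_of_ae_le _ ?_
    have h : ∀ᵐ x ∂μ, ∀ n, u n x ≤ essSup (u n) μ :=
      ae_all_iff.2 fun n => ENNReal.ae_le_essSup (u n)
    filter_upwards [h] with x hx
    exact ENNReal.tsum_le_tsum hx

/-- `X = {u measurable : ‖u‖_X < ∞}`, as a set of functions defined everywhere. -/
def QuasiBanachFunctionLattice.functions {P : Type*} [MeasurableSpace P] {μ : Measure P}
    (X : QuasiBanachFunctionLattice μ) : Set (P → EReal) :=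
  {u | AEMeasurable u μ ∧ X.norm u < ⊤}

/-! ## Curves, modulus and upper gradients -/

/-- A nonconstant rectifiable curve `γ : [0, len] → P`, parametrized by arc length. -/
structure RectifiableCurve (P : Type*) [MetricSpace P] where
  toFun : ℝ → P
  len : ℝ
  len_pos : 0 < len
  unitSpeed : HasUnitSpeedOn toFun (Icc 0 len)

/-- The path integral `∫_γ ρ ds`. -/
def RectifiableCurve.integral {P : Type*} [MetricSpace P] (γ : RectifiableCurve P)
    (ρ : P → ℝ≥0∞) : ℝ≥0∞ :=
  ∫⁻ t in Icc 0 γ.len, ρ (γ.toFun t)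

section

variable {P : Type*} [MetricSpace P] [MeasurableSpace P] [BorelSpace P] {μ : Measure P}

/-- The curve family `Γ` has zero `X`-modulus. -/
def ZeroModulus (X : QuasiBanachFunctionLattice μ) (Γ : Set (RectifiableCurve P)) : Prop :=
  ∃ ρ : P → ℝ≥0∞, Measurable ρ ∧ (fun x => (ρ x : EReal)) ∈ X.functions ∧
    ∀ γ ∈ Γ, γ.integral ρ = ⊤

/-- `g` is an upper gradient of `u`. In `EReal` one has `(⊤ - ⊤).abs = (⊥ - ⊥).abs = ⊤`, which is
the convention `|(±∞) - (±∞)| = ∞`. -/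
def IsUpperGradient (u : P → EReal) (g : P → ℝ≥0∞) : Prop :=
  Measurable g ∧ ∀ γ : RectifiableCurve P,
    (u (γ.toFun 0) - u (γ.toFun γ.len)).abs ≤ γ.integral g

/-- `‖u‖_{N¹X} = ‖u‖_X + inf_g ‖g‖_X`, the infimum being over all upper gradients of `u`. -/
def newtonNorm (X : QuasiBanachFunctionLattice μ) (u : P → EReal) : ℝ≥0∞ :=
  X.norm u + ⨅ (g : P → ℝ≥0∞) (_ : IsUpperGradient u g), X.norm (fun x => (g x : EReal))

/-- The Newtonian space `N¹X`. -/
def newtonSpace (X : QuasiBanachFunctionLattice μ) : Set (P → EReal) :=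
  {u | u ∈ X.functions ∧ newtonNorm X u < ⊤}

/-! ## Capacity and quasicontinuity -/

/-- The Sobolev `X`-capacity `C_X`. -/
def capacity (X : QuasiBanachFunctionLattice μ) (E : Set P) : ℝ≥0∞ :=
  ⨅ (u : P → EReal) (_ : u ∈ newtonSpace X ∧ ∀ x ∈ E, 1 ≤ u x), newtonNorm X u

/-- `C_X` is a `c`-quasiouter capacity. -/
def IsQuasiouterWith (X : QuasiBanachFunctionLattice μ) (c : ℝ≥0) : Prop :=
  ∀ E : Set P, ⨅ (G : Set P) (_ : IsOpen G ∧ E ⊆ G), capacity X G ≤ c * capacity X E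

/-- The restriction of `u` to `A` is a real-valued continuous function. -/
def RealContinuousOn (u : P → EReal) (A : Set P) : Prop :=
  ContinuousOn u A ∧ ∀ x ∈ A, u x ≠ ⊤ ∧ u x ≠ ⊥

def WeaklyQuasicontinuous (X : QuasiBanachFunctionLattice μ) (u : P → EReal) : Prop :=
  ∀ ε : ℝ≥0∞, 0 < ε → ∃ E : Set P, capacity X E < ε ∧ RealContinuousOn u Eᶜ

def Quasicontinuous (X : QuasiBanachFunctionLattice μ) (u : P → EReal) : Prop :=
  ∀ ε : ℝ≥0∞, 0 < ε → ∃ G : Set P, IsOpen G ∧ capacity X G < ε ∧ RealContinuousOn u Gᶜ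

/-- (A): every function in `N¹X` is quasicontinuous. -/
def PropertyA (X : QuasiBanachFunctionLattice μ) : Prop :=
  ∀ u ∈ newtonSpace X, Quasicontinuous X u

/-- (B): `C_X` is an outer capacity. -/
def PropertyB (X : QuasiBanachFunctionLattice μ) : Prop :=
  IsQuasiouterWith X 1

/-- (C): `C_X` is a quasiouter capacity. -/
def PropertyC (X : QuasiBanachFunctionLattice μ) : Prop :=
  ∃ c : ℝ≥0, 1 ≤ c ∧ IsQuasiouterWith X c

/-- (D): every weakly quasicontinuous function is quasicontinuous. -/
def PropertyD (X : QuasiBanachFunctionLattice μ) : Prop :=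
  ∀ u : P → EReal, WeaklyQuasicontinuous X u → Quasicontinuous X u

/-- (E): `C_X` is an outer capacity for sets of zero capacity. -/
def PropertyE (X : QuasiBanachFunctionLattice μ) : Prop :=
  ∀ E : Set P, capacity X E = 0 → ∀ ε : ℝ≥0∞, 0 < ε →
    ∃ G : Set P, IsOpen G ∧ E ⊆ G ∧ capacity X G < ε

/-- (F): every function in `N¹X` agrees, outside a set of zero capacity, with a quasicontinuous
function. -/
def PropertyF (X : QuasiBanachFunctionLattice μ) : Prop :=
  ∀ u ∈ newtonSpace X, ∃ v : P → EReal, Quasicontinuous X v ∧ capacity X {x | v x ≠ u x} = 0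

/-- (G): every function in `N¹X` is weakly quasicontinuous. -/
def PropertyG (X : QuasiBanachFunctionLattice μ) : Prop :=
  ∀ u ∈ newtonSpace X, WeaklyQuasicontinuous X u

end

/-! ## The Sierpinski carpet -/

/-- The similarity of the plane that maps the unit square onto the closed square with side `1/3` in
column `a.1` and row `a.2` of its division into nine squares. -/
def carpetMap (a : Fin 3 × Fin 3) (x : EuclideanSpace ℝ (Fin 2)) : EuclideanSpace ℝ (Fin 2) :=
  !₂[(x 0 + ((a.1 : ℕ) : ℝ)) / 3, (x 1 + ((a.2 : ℕ) : ℝ)) / 3]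

/-- The `n`-th stage of the construction: `8 ^ n` closed squares with side `3 ^ (-n)`. -/
def carpetStage : ℕ → Set (EuclideanSpace ℝ (Fin 2))
  | 0 => {x | ∀ i, x i ∈ Icc (0 : ℝ) 1}
  | n + 1 => ⋃ a ∈ {a : Fin 3 × Fin 3 | a ≠ (1, 1)}, carpetMap a '' carpetStage n

/-- The Sierpinski carpet `S_{1/3}`. -/
def carpet : Set (EuclideanSpace ℝ (Fin 2)) := ⋂ n, carpetStage n

/-- The `log 8 / log 3`-dimensional Hausdorff measure on the carpet, divided by its total mass. -/
def carpetMeasure : Measure carpet :=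
  (Measure.hausdorffMeasure (X := carpet) (Real.log 8 / Real.log 3) univ)⁻¹ •
    Measure.hausdorffMeasure (X := carpet) (Real.log 8 / Real.log 3)

end Newtonian

end

open Newtonian

/-! Everything rests on one Borel null set that every nonconstant rectifiable curve must meet for a
positive length of time. The three columns of the carpet keep 3, 2 and 3 of the eight cells, so each
coordinate marginal of the Hausdorff measure is subinvariant under `t ↦ (t + i) / 3` with weights
3/8, 2/8, 3/8, while Lebesgue measure has weights 1/3. Since `∑ √(p i * q i) < 1`, iterating drives
the common part of the two measures to zero: they are mutually singular
(`IsTernarySubinvariant.mutuallySingular`).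

Choose for each coordinate a Borel set that is null for the marginal and of full Lebesgue measure in
`[0, 1]`; the points of the carpet with some coordinate in it form a null set. A nonconstant curve
has a nonconstant, 1-Lipschitz coordinate function, whose range contains an interval. If the curve
spent no time in the null set, almost all of that interval would be the Lipschitz image of a set of
times of measure zero (`integral_blockingDensity`). So `∞` times the indicator of the null set has
norm zero in every lattice and is an upper gradient of every function, and `N¹X = X`.

For `L^∞` this makes the capacity vanish on null sets and be at least 1 on all others. Nonempty open
sets have positive measure, so quasicontinuity is plain continuity and weak quasicontinuity is
continuity off a null set. Single points refute (B)–(E), a compact nowhere dense set of positive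
measure refutes (A), (F), (G).

That the Hausdorff measure of the carpet is finite and positive comes from the natural covers by
cells and from the mass distribution principle for the uniform measure on addresses. -/

noncomputable section

namespace Newtonian

open scoped Topology MeasureTheory

/-! ## Geometry of the carpet -/

/-- The column (`j = 0`) or row (`j = 1`) of a cell. -/
def digit (a : Fin 3 × Fin 3) (j : Fin 2) : Fin 3 := ![a.1, a.2] j

theorem carpetMap_apply (a : Fin 3 × Fin 3) (x : EuclideanSpace ℝ (Fin 2)) (j : Fin 2) :
    carpetMap a x j = (x j + ((digit a j : ℕ) : ℝ)) / 3 := by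
  fin_cases j <;> rfl

theorem eq_of_digit_eq {a b : Fin 3 × Fin 3} (h : ∀ j, digit a j = digit b j) : a = b :=
  Prod.ext (h 0) (h 1)

theorem carpetMap_injective (a : Fin 3 × Fin 3) : Function.Injective (carpetMap a) := by
  intro x y h
  ext j
  have := congrArg (fun z : EuclideanSpace ℝ (Fin 2) => z j) h
  simp only [carpetMap_apply] at this
  linarith

theorem dist_carpetMap (a : Fin 3 × Fin 3) (x y : EuclideanSpace ℝ (Fin 2)) :
    dist (carpetMap a x) (carpetMap a y) = 3⁻¹ * dist x y := by
  have h : carpetMap a x - carpetMap a y = (3⁻¹ : ℝ) • (x - y) := by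
    ext j
    simp only [PiLp.sub_apply, PiLp.smul_apply, carpetMap_apply, smul_eq_mul]
    ring
  rw [dist_eq_norm, h, norm_smul, dist_eq_norm]
  norm_num

theorem continuous_carpetMap (a : Fin 3 × Fin 3) : Continuous (carpetMap a) := by
  refine (LipschitzWith.of_dist_le_mul (K := 3⁻¹) fun x y => ?_).continuous
  rw [dist_carpetMap]
  simp

theorem carpetStage_succ_subset (n : ℕ) : carpetStage (n + 1) ⊆ carpetStage n := by
  induction n with
  | zero =>
    intro x hx
    simp only [carpetStage, mem_iUnion] at hx
    obtain ⟨a, -, y, hy, rfl⟩ := hx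
    intro j
    have h1 := hy j
    have h2 : ((digit a j : ℕ) : ℝ) ≤ 2 := by
      exact_mod_cast Nat.le_of_lt_succ (digit a j).is_lt
    have h3 : (0 : ℝ) ≤ ((digit a j : ℕ) : ℝ) := Nat.cast_nonneg _
    rw [carpetMap_apply]
    constructor <;> linarith [h1.1, h1.2]
  | succ n ih =>
    exact biUnion_mono subset_rfl fun a _ => image_mono ih

theorem carpetStage_antitone : Antitone carpetStage := antitone_nat_of_succ_le carpetStage_succ_subset

theorem isCompact_carpetStage (n : ℕ) : IsCompact (carpetStage n) := by
  induction n with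
  | zero =>
    have h : carpetStage 0 = (EuclideanSpace.equiv (Fin 2) ℝ).toHomeomorph ⁻¹'
        (univ.pi fun _ => Icc (0 : ℝ) 1) := by
      ext x
      exact ⟨fun h i _ => h i, fun h i => h i (mem_univ i)⟩
    rw [h, Homeomorph.isCompact_preimage]
    exact isCompact_univ_pi fun _ => isCompact_Icc
  | succ n ih =>
    exact (toFinite _).isCompact_biUnion fun a _ => ih.image (continuous_carpetMap a)

theorem isCompact_carpet : IsCompact carpet :=
  (isCompact_carpetStage 0).of_isClosed_subset
    (isClosed_iInter fun n => (isCompact_carpetStage n).isClosed) (iInter_subset _ 0)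

theorem mem_Icc_of_mem_carpet {x : EuclideanSpace ℝ (Fin 2)} (hx : x ∈ carpet) (j : Fin 2) :
    x j ∈ Icc (0 : ℝ) 1 :=
  mem_iInter.1 hx 0 j

theorem carpetMap_mem_carpet {a : Fin 3 × Fin 3} (ha : a ≠ (1, 1))
    {x : EuclideanSpace ℝ (Fin 2)} (hx : x ∈ carpet) : carpetMap a x ∈ carpet := by
  refine mem_iInter.2 fun n => carpetStage_succ_subset n ?_
  exact mem_biUnion (x := a) ha (mem_image_of_mem _ (mem_iInter.1 hx n))

/-- Each stage only provides a cell depending on the stage. If every cell failed, it would fail from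
some stage on; there are finitely many cells, so one stage defeats them all. Injectivity of
`carpetMap a` makes the preimages at different stages the same point. -/
theorem exists_carpetMap_eq {x : EuclideanSpace ℝ (Fin 2)} (hx : x ∈ carpet) :
    ∃ a : Fin 3 × Fin 3, a ≠ (1, 1) ∧ ∃ y ∈ carpet, carpetMap a y = x := by
  by_contra! hcon
  have h : ∀ a : Fin 3 × Fin 3, ∃ n, a ≠ (1, 1) → x ∉ carpetMap a '' carpetStage n := by
    intro a
    by_contra! h
    obtain ⟨ha, y, -, hy⟩ := h 0
    refine hcon a ha y (mem_iInter.2 fun n => ?_) hy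
    obtain ⟨-, z, hz, hzx⟩ := h n
    rwa [carpetMap_injective a (hy.trans hzx.symm)]
  choose N hN using h
  have hx' := mem_iInter.1 hx (Finset.univ.sup N + 1)
  simp only [carpetStage, mem_iUnion] at hx'
  obtain ⟨a, ha, hxa⟩ := hx'
  exact hN a ha (image_mono (carpetStage_antitone (Finset.le_sup (Finset.mem_univ a))) hxa)

/-- The cells of the division that are kept. -/
def keptCells : Finset (Fin 3 × Fin 3) := Finset.univ.filter (· ≠ (1, 1))

theorem mem_keptCells {a : Fin 3 × Fin 3} : a ∈ keptCells ↔ a ≠ (1, 1) := by simp [keptCells]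

theorem card_keptCells : keptCells.card = 8 := by decide

/-- Every point of the carpet lies in arbitrarily small similar copies of the carpet. -/
theorem exists_similarity (n : ℕ) {x : EuclideanSpace ℝ (Fin 2)} (hx : x ∈ carpet) :
    ∃ F : EuclideanSpace ℝ (Fin 2) → EuclideanSpace ℝ (Fin 2),
      (∀ y z, dist (F y) (F z) = (3⁻¹ : ℝ) ^ n * dist y z) ∧ MapsTo F carpet carpet ∧
        x ∈ F '' carpet := by
  induction n generalizing x with
  | zero => exact ⟨id, by simp, mapsTo_id _, by simpa using hx⟩
  | succ n ih =>
    obtain ⟨a, ha, y, hy, rfl⟩ := exists_carpetMap_eq hx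
    obtain ⟨F, hF, hFm, hFx⟩ := ih hy
    refine ⟨carpetMap a ∘ F, fun y z => ?_, fun z hz => carpetMap_mem_carpet ha (hFm hz), ?_⟩
    · simp only [Function.comp, dist_carpetMap, hF]
      ring
    · rw [image_comp]
      exact mem_image_of_mem _ hFx

/-! ## The Hausdorff measure of the carpet -/

/-- The dimension of the carpet. -/
def carpetDim : ℝ := Real.log 8 / Real.log 3

theorem carpetDim_pos : 0 < carpetDim :=
  div_pos (Real.log_pos (by norm_num)) (Real.log_pos (by norm_num))

theorem three_inv_rpow_carpetDim : (3⁻¹ : ℝ≥0) ^ carpetDim = 8⁻¹ := by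
  rw [NNReal.inv_rpow, inv_inj]
  refine NNReal.eq ?_
  rw [NNReal.coe_rpow, carpetDim]
  exact Real.rpow_logb (b := 3) (x := 8) (by norm_num) (by norm_num) (by norm_num)

theorem ennreal_three_inv_pow_rpow_carpetDim (n : ℕ) :
    ((3⁻¹ : ℝ≥0∞) ^ n) ^ carpetDim = 8⁻¹ ^ n := by
  have h := three_inv_rpow_carpetDim
  have h' : (3⁻¹ : ℝ≥0∞) ^ carpetDim = 8⁻¹ := by
    have := congrArg ((↑) : ℝ≥0 → ℝ≥0∞) h
    rw [ENNReal.coe_rpow_of_nonneg _ carpetDim_pos.le] at this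
    simpa using this
  rw [← ENNReal.rpow_natCast, ← ENNReal.rpow_mul, mul_comm, ENNReal.rpow_mul, h',
    ENNReal.rpow_natCast]

/-! ### Finiteness of the Hausdorff measure. -/

open scoped Classical in
theorem exists_cover_carpetStage (n : ℕ) :
    ∃ F : Finset (Set (EuclideanSpace ℝ (Fin 2))), F.card ≤ 8 ^ n ∧
      (∀ t ∈ F, Metric.ediam t ≤ 3⁻¹ ^ n * Metric.ediam (carpetStage 0)) ∧
      carpetStage n ⊆ ⋃ t ∈ F, t := by
  induction n with
  | zero => exact ⟨{carpetStage 0}, by simp, by simp, by simp⟩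
  | succ n ih =>
    obtain ⟨F, hc, hd, hs⟩ := ih
    refine ⟨(keptCells ×ˢ F).image fun p => carpetMap p.1 '' p.2, ?_, ?_, ?_⟩
    · refine Finset.card_image_le.trans ?_
      rw [Finset.card_product, card_keptCells, pow_succ']
      exact Nat.mul_le_mul_left _ hc
    · intro t ht
      simp only [Finset.mem_image, Finset.mem_product] at ht
      obtain ⟨⟨a, t⟩, ⟨-, ht⟩, rfl⟩ := ht
      have hl : LipschitzWith 3⁻¹ (carpetMap a) :=
        LipschitzWith.of_dist_le_mul fun x y => by rw [dist_carpetMap]; simp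
      refine (hl.ediam_image_le t).trans ?_
      rw [pow_succ', mul_assoc]
      refine mul_le_mul' (by simp) (hd t ht)
    · intro x hx
      simp only [carpetStage, mem_iUnion] at hx
      obtain ⟨a, ha, y, hy, rfl⟩ := hx
      have hy' := hs hy
      simp only [mem_iUnion] at hy' ⊢
      obtain ⟨t, ht, hyt⟩ := hy'
      refine ⟨carpetMap a '' t, ?_, mem_image_of_mem _ hyt⟩
      exact Finset.mem_image.2 ⟨(a, t), Finset.mem_product.2 ⟨mem_keptCells.2 ha, ht⟩, rfl⟩

/-- At most `8 ^ n` pieces of diameter at most `3⁻¹ ^ n * M` cover the carpet, and `3⁻¹ ^ carpetDim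
= 8⁻¹`, so every such cover has `carpetDim`-sum at most `M ^ carpetDim`. -/
theorem hausdorffMeasure_carpet_lt_top : μH[carpetDim] carpet < ⊤ := by
  choose F hc hd hs using exists_cover_carpetStage
  set M := Metric.ediam (carpetStage 0)
  have hM : M ≠ ⊤ := (isCompact_carpetStage 0).isBounded.ediam_ne_top
  have h := Measure.hausdorffMeasure_le_liminf_sum carpetDim carpet (l := atTop)
    (fun n : ℕ => 3⁻¹ ^ n * M) (by
      have := ENNReal.Tendsto.mul_const (b := M) (ENNReal.tendsto_pow_atTop_nhds_zero_of_lt_one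
        (r := 3⁻¹) (by simp)) (Or.inr hM)
      simpa using this)
    (fun n (i : F n) => (i : Set _)) (Eventually.of_forall fun n i => hd n i i.2)
    (Eventually.of_forall fun n => (iInter_subset _ n).trans ((hs n).trans (by
      rw [iUnion_subtype])))
  refine lt_of_le_of_lt h (lt_of_le_of_lt (b := M ^ carpetDim) ?_
    (ENNReal.rpow_lt_top_of_nonneg carpetDim_pos.le hM))
  refine (liminf_le_liminf (v := fun _ => M ^ carpetDim) (Eventually.of_forall fun n => ?_)).trans
    (by simp)
  calc ∑ i : F n, Metric.ediam (i : Set (EuclideanSpace ℝ (Fin 2))) ^ carpetDim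
      ≤ ∑ i : F n, (8⁻¹ ^ n * M ^ carpetDim) := by
        refine Finset.sum_le_sum fun i _ => ?_
        rw [← ennreal_three_inv_pow_rpow_carpetDim, ← ENNReal.mul_rpow_of_nonneg _ _ carpetDim_pos.le]
        exact ENNReal.rpow_le_rpow (hd n i i.2) carpetDim_pos.le
    _ ≤ (8 ^ n : ℝ≥0∞) * (8⁻¹ ^ n * M ^ carpetDim) := by
        rw [Finset.sum_const, nsmul_eq_mul]
        gcongr
        simpa using (Nat.cast_le (α := ℝ≥0∞)).2 (hc n)
    _ = M ^ carpetDim := by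
        rw [← mul_assoc, ← mul_pow, ENNReal.mul_inv_cancel (by simp) (by simp), one_pow, one_mul]

/-! ### Positivity of the Hausdorff measure, through the measure on addresses. -/

/-- The integer formed by the first `n` ternary digits. -/
def ternaryPrefix (x : ℕ → Fin 3) : ℕ → ℕ
  | 0 => 0
  | n + 1 => 3 * ternaryPrefix x n + x n

theorem eq_of_ternaryPrefix_eq {x y : ℕ → Fin 3} {n : ℕ}
    (h : ternaryPrefix x n = ternaryPrefix y n) : ∀ i < n, x i = y i := by
  induction n with
  | zero => simp
  | succ n ih =>
    simp only [ternaryPrefix] at h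
    have h1 := (x n).is_lt
    have h2 := (y n).is_lt
    intro i hi
    rcases Nat.lt_succ_iff_lt_or_eq.1 hi with hi | rfl
    · exact ih (by omega) i hi
    · exact Fin.ext (by omega)

theorem sum_ofDigitsTerm_eq (x : ℕ → Fin 3) (n : ℕ) :
    ∑ i ∈ Finset.range n, Real.ofDigitsTerm x i = ternaryPrefix x n / 3 ^ n := by
  induction n with
  | zero => simp [ternaryPrefix]
  | succ n ih =>
    rw [Finset.sum_range_succ, ih, ternaryPrefix, Real.ofDigitsTerm]
    push_cast
    field_simp
    ring

theorem ofDigits_mem_Icc (x : ℕ → Fin 3) (n : ℕ) :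
    3 ^ n * Real.ofDigits x ∈ Icc (ternaryPrefix x n : ℝ) (ternaryPrefix x n + 1) := by
  have h : 3 ^ n * Real.ofDigits x
      = ternaryPrefix x n + Real.ofDigits (fun i => x (i + n)) := by
    rw [Real.ofDigits_eq_sum_add_ofDigits x n, sum_ofDigitsTerm_eq]
    push_cast
    field_simp
  rw [h]
  constructor <;> linarith [Real.ofDigits_nonneg fun i => x (i + n),
    Real.ofDigits_le_one fun i => x (i + n)]

/-- Ternary expansions are not unique, so close points need not share a prefix. But `3 ^ n` times
each point lies within 1 above its prefix, so the prefixes differ by less than 2. -/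
theorem abs_ternaryPrefix_sub_le {x y : ℕ → Fin 3} {n : ℕ}
    (h : |Real.ofDigits x - Real.ofDigits y| < 3⁻¹ ^ n) :
    (ternaryPrefix x n : ℤ) ∈ Finset.Icc ((ternaryPrefix y n : ℤ) - 1) (ternaryPrefix y n + 1) := by
  have hx := ofDigits_mem_Icc x n
  have hy := ofDigits_mem_Icc y n
  have h3 : (0 : ℝ) < 3 ^ n := by positivity
  have h' : |3 ^ n * Real.ofDigits x - 3 ^ n * Real.ofDigits y| < 1 := by
    rw [← mul_sub, abs_mul, abs_of_pos h3]
    calc 3 ^ n * |Real.ofDigits x - Real.ofDigits y| < 3 ^ n * 3⁻¹ ^ n := by gcongr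
      _ = 1 := by rw [← mul_pow]; norm_num
  rw [abs_lt] at h'
  have h1 : (ternaryPrefix x n : ℝ) < ternaryPrefix y n + 2 := by linarith [hx.1, hy.2]
  have h2 : (ternaryPrefix y n : ℝ) < ternaryPrefix x n + 2 := by linarith [hx.2, hy.1]
  rw [Finset.mem_Icc]
  have h1' : ternaryPrefix x n < ternaryPrefix y n + 2 := by exact_mod_cast h1
  have h2' : ternaryPrefix y n < ternaryPrefix x n + 2 := by exact_mod_cast h2
  omega

/-- The type of kept cells. -/
abbrev Cell : Type := {a : Fin 3 × Fin 3 // a ≠ (1, 1)}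

/-- The point of the carpet with a given address. -/
def carpetPoint (ω : ℕ → Cell) : EuclideanSpace ℝ (Fin 2) :=
  WithLp.toLp 2 fun j => Real.ofDigits fun k => digit (ω k) j

theorem carpetPoint_apply (ω : ℕ → Cell) (j : Fin 2) :
    carpetPoint ω j = Real.ofDigits fun k => digit (ω k) j := rfl

theorem carpetPoint_eq_carpetMap (ω : ℕ → Cell) :
    carpetPoint ω = carpetMap (ω 0) (carpetPoint fun k => ω (k + 1)) := by
  ext j
  rw [carpetMap_apply, carpetPoint_apply, carpetPoint_apply,
    Real.ofDigits_eq_sum_add_ofDigits _ 1]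
  simp only [Finset.sum_range_one, Real.ofDigitsTerm]
  push_cast
  ring

theorem carpetPoint_mem_carpet (ω : ℕ → Cell) : carpetPoint ω ∈ carpet := by
  refine mem_iInter.2 fun n => ?_
  induction n generalizing ω with
  | zero =>
    exact fun j => ⟨Real.ofDigits_nonneg _, Real.ofDigits_le_one _⟩
  | succ n ih =>
    rw [carpetPoint_eq_carpetMap]
    exact mem_biUnion (x := (ω 0 : Fin 3 × Fin 3)) (ω 0).2 (mem_image_of_mem _ (ih _))

theorem measurable_carpetPoint : Measurable carpetPoint := by
  refine (WithLp.measurable_toLp 2 _).comp (measurable_pi_lambda _ fun j => ?_)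
  refine (Real.continuous_ofDigits (b := 3)).measurable.comp (measurable_pi_lambda _ fun k => ?_)
  exact (measurable_of_finite fun a : Cell => digit a j).comp (measurable_pi_apply k)

/-- The uniform distribution on addresses. -/
def addressMeasure : Measure (ℕ → Cell) :=
  Measure.infinitePi fun _ => ProbabilityTheory.uniformOn (univ : Set Cell)

instance : IsProbabilityMeasure (ProbabilityTheory.uniformOn (univ : Set Cell)) :=
  ProbabilityTheory.isProbabilityMeasure_uniformOn finite_univ ⟨⟨(0, 0), by decide⟩, mem_univ _⟩

instance : IsProbabilityMeasure addressMeasure := by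
  unfold addressMeasure
  infer_instance

theorem addressMeasure_cylinder (d : ℕ → Cell) (n : ℕ) :
    addressMeasure {ω | ∀ i < n, ω i = d i} = 8⁻¹ ^ n := by
  have h : {ω : ℕ → Cell | ∀ i < n, ω i = d i} = Set.pi (Finset.range n) fun i => {d i} := by
    ext ω
    simp
  rw [h, addressMeasure, Measure.infinitePi_pi _ (fun i _ => measurableSet_singleton _)]
  have : Fintype.card Cell = 8 := by decide
  simp [ProbabilityTheory.uniformOn_univ, this]

/-- Relative to one fixed address, the prefix in each coordinate shifts by at most 1, which leaves 3
· 3 = 9 pairs. A pair of prefixes determines the first `n` cells, hence a cylinder of mass `8⁻¹ ^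
n`. -/
theorem addressMeasure_preimage_le {A : Set (EuclideanSpace ℝ (Fin 2))} {n : ℕ}
    (hA : Metric.ediam A < 3⁻¹ ^ n) : addressMeasure (carpetPoint ⁻¹' A) ≤ 9 * 8⁻¹ ^ n := by
  rcases (carpetPoint ⁻¹' A).eq_empty_or_nonempty with h | ⟨τ, hτ⟩
  · simp [h]
  let K : (ℕ → Cell) → Fin 2 → ℤ := fun ω j => ternaryPrefix (fun k => digit (ω k) j) n
  let I : Finset (ℤ × ℤ) := Finset.Icc (K τ 0 - 1) (K τ 0 + 1) ×ˢ Finset.Icc (K τ 1 - 1) (K τ 1 + 1)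
  have hsub : carpetPoint ⁻¹' A ⊆ ⋃ p ∈ I, {ω | K ω 0 = p.1 ∧ K ω 1 = p.2} := by
    intro ω hω
    have hd : ∀ j, |carpetPoint ω j - carpetPoint τ j| < 3⁻¹ ^ n := by
      intro j
      have h1 : edist (carpetPoint ω) (carpetPoint τ) < ENNReal.ofReal (3⁻¹ ^ n) := by
        refine ((Metric.edist_le_ediam_of_mem (mem_preimage.1 hω) hτ).trans_lt hA).trans_le (le_of_eq ?_)
        rw [ENNReal.ofReal_pow (by norm_num), ENNReal.ofReal_inv_of_pos (by norm_num)]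
        simp
      rw [edist_lt_ofReal] at h1
      refine lt_of_le_of_lt ?_ h1
      rw [dist_eq_norm]
      exact PiLp.norm_apply_le (carpetPoint ω - carpetPoint τ) j
    refine mem_biUnion (x := (K ω 0, K ω 1)) ?_ ⟨rfl, rfl⟩
    exact Finset.mem_product.2 ⟨abs_ternaryPrefix_sub_le (hd 0), abs_ternaryPrefix_sub_le (hd 1)⟩
  have hcell : ∀ p : ℤ × ℤ, addressMeasure {ω | K ω 0 = p.1 ∧ K ω 1 = p.2} ≤ 8⁻¹ ^ n := by
    intro p
    rcases {ω | K ω 0 = p.1 ∧ K ω 1 = p.2}.eq_empty_or_nonempty with h | ⟨d, hd⟩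
    · simp [h]
    rw [← addressMeasure_cylinder d n]
    refine measure_mono fun ω hω i hi => Subtype.ext (eq_of_digit_eq fun j => ?_)
    have hj : K ω j = K d j := by
      fin_cases j
      · exact hω.1.trans hd.1.symm
      · exact hω.2.trans hd.2.symm
    exact eq_of_ternaryPrefix_eq (Int.ofNat_inj.1 hj) i hi
  calc addressMeasure (carpetPoint ⁻¹' A)
      ≤ ∑ p ∈ I, addressMeasure {ω | K ω 0 = p.1 ∧ K ω 1 = p.2} :=
        (measure_mono hsub).trans (measure_biUnion_finset_le _ _)
    _ ≤ ∑ p ∈ I, 8⁻¹ ^ n := Finset.sum_le_sum fun p _ => hcell p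
    _ = 9 * 8⁻¹ ^ n := by
        have hI : I.card = 9 := by
          simp only [I, Finset.card_product, Int.card_Icc]
          ring_nf
          rfl
        rw [Finset.sum_const, hI, nsmul_eq_mul]
        norm_num

/-- The Frostman condition: at the scale with `3⁻¹ ^ (n + 1) ≤ diam A < 3⁻¹ ^ n` the bound `9 * 8⁻¹
^ n` equals `72 * 8⁻¹ ^ (n + 1)`. -/
theorem map_carpetPoint_le (A : Set (EuclideanSpace ℝ (Fin 2))) (hA : Metric.ediam A ≤ 3⁻¹) :
    (addressMeasure.map carpetPoint) A ≤ 72 * Metric.ediam A ^ carpetDim := by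
  have hcl : ∀ n : ℕ, Metric.ediam A < 3⁻¹ ^ n →
      (addressMeasure.map carpetPoint) A ≤ 9 * 8⁻¹ ^ n := by
    intro n hn
    -- The set `A` is arbitrary; its closure is measurable and has the same diameter.
    refine (measure_mono subset_closure).trans ?_
    rw [Measure.map_apply measurable_carpetPoint isClosed_closure.measurableSet]
    exact addressMeasure_preimage_le (by rwa [Metric.ediam_closure])
  have hlim : Tendsto (fun n : ℕ => (3⁻¹ : ℝ≥0∞) ^ n) atTop (𝓝 0) :=
    ENNReal.tendsto_pow_atTop_nhds_zero_of_lt_one (by simp)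
  rcases eq_or_ne (Metric.ediam A) 0 with h0 | h0
  · have h1 : Tendsto (fun n : ℕ => 9 * (8⁻¹ : ℝ≥0∞) ^ n) atTop (𝓝 (9 * 0)) :=
      ENNReal.Tendsto.const_mul (ENNReal.tendsto_pow_atTop_nhds_zero_of_lt_one (by simp))
        (Or.inr (by simp))
    refine (ge_of_tendsto' h1 fun n => hcl n ?_).trans (by simp)
    rw [h0]
    exact ENNReal.pow_pos (by simp) n
  · have hex : ∃ n : ℕ, (3⁻¹ : ℝ≥0∞) ^ n ≤ Metric.ediam A :=
      (hlim.eventually (ge_mem_nhds (pos_iff_ne_zero.2 h0))).exists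
    classical
    obtain ⟨n, hn⟩ : ∃ n, Nat.find hex = n + 1 := by
      refine Nat.exists_eq_succ_of_ne_zero fun h => ?_
      have := Nat.find_spec hex
      rw [h, pow_zero] at this
      have h3 := this.trans hA
      norm_num at h3
    have h1 : (3⁻¹ : ℝ≥0∞) ^ (n + 1) ≤ Metric.ediam A := hn ▸ Nat.find_spec hex
    have h2 : Metric.ediam A < 3⁻¹ ^ n := not_le.1 (Nat.find_min hex (by omega))
    calc (addressMeasure.map carpetPoint) A ≤ 9 * 8⁻¹ ^ n := hcl n h2
      _ = 72 * 8⁻¹ ^ (n + 1) := by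
          have h8 : (72 : ℝ≥0∞) * 8⁻¹ = 9 := by
            rw [show (72 : ℝ≥0∞) = 9 * 8 by norm_num, mul_assoc,
              ENNReal.mul_inv_cancel (by simp) (by simp), mul_one]
          rw [pow_succ', ← mul_assoc, h8]
      _ ≤ 72 * Metric.ediam A ^ carpetDim := by
          rw [← ennreal_three_inv_pow_rpow_carpetDim]
          gcongr
          exact carpetDim_pos.le

theorem hausdorffMeasure_carpet_pos : 0 < μH[carpetDim] carpet := by
  have h := Measure.le_hausdorffMeasure carpetDim ((72 : ℝ≥0∞)⁻¹ • addressMeasure.map carpetPoint)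
    3⁻¹ (by simp) fun A hA => by
      rw [Measure.smul_apply, smul_eq_mul]
      refine (mul_le_mul_right (map_carpetPoint_le A hA) _).trans (le_of_eq ?_)
      rw [← mul_assoc, ENNReal.inv_mul_cancel (by simp) (by simp), one_mul]
  refine lt_of_lt_of_le ?_ (h carpet)
  rw [Measure.smul_apply, Measure.map_apply measurable_carpetPoint isCompact_carpet.measurableSet,
    preimage_eq_univ_iff.2 (by rintro _ ⟨ω, rfl⟩; exact carpetPoint_mem_carpet ω), measure_univ]
  simp

/-- The ball contains a small similar copy of the whole carpet, and a similarity scales the measure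
by a nonzero factor. -/
theorem hausdorffMeasure_carpet_inter_ball_pos {x : EuclideanSpace ℝ (Fin 2)} (hx : x ∈ carpet)
    {r : ℝ} (hr : 0 < r) : 0 < μH[carpetDim] (carpet ∩ Metric.ball x r) := by
  obtain ⟨C, hC⟩ := Metric.isBounded_iff.1 isCompact_carpet.isBounded
  have hlim : Tendsto (fun n : ℕ => (3⁻¹ : ℝ) ^ n * C) atTop (𝓝 (0 * C)) :=
    (tendsto_pow_atTop_nhds_zero_of_lt_one (by norm_num) (by norm_num)).mul_const C
  rw [zero_mul] at hlim
  obtain ⟨n, hn⟩ := (hlim.eventually (gt_mem_nhds hr)).exists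
  obtain ⟨F, hF, hFm, y, hy, rfl⟩ := exists_similarity n hx
  have hsub : F '' carpet ⊆ carpet ∩ Metric.ball (F y) r := by
    rintro _ ⟨z, hz, rfl⟩
    refine ⟨hFm hz, ?_⟩
    rw [Metric.mem_ball, hF]
    exact lt_of_le_of_lt (mul_le_mul_of_nonneg_left (hC hz hy) (by positivity)) hn
  have hanti : AntilipschitzWith (3 ^ n) F := by
    refine AntilipschitzWith.of_le_mul_dist fun a b => ?_
    rw [hF, ← mul_assoc]
    push_cast
    rw [← mul_pow]
    norm_num
  have h := hanti.le_hausdorffMeasure_image carpetDim_pos.le carpet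
  refine lt_of_lt_of_le (pos_iff_ne_zero.2 fun h0 => ?_) (measure_mono hsub)
  rw [h0, mul_zero] at h
  exact hausdorffMeasure_carpet_pos.ne' (le_antisymm h bot_le)

/-! ## Singularity of the projections -/

/-- Subinvariance of a measure on the line under the iterated function system `t ↦ (t + i) / 3`
with weights `p i`. -/
def IsTernarySubinvariant (μ : Measure ℝ) (p : Fin 3 → ℝ≥0) : Prop :=
  ∀ A : Set ℝ, MeasurableSet A →
    μ A ≤ ∑ i, p i * μ ((fun t : ℝ => (t + ((i : ℕ) : ℝ)) / 3) ⁻¹' A)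

/-- Glues sets on the three thirds of the unit interval. -/
def glueThirds (T : Fin 3 → Set ℝ) : Set ℝ :=
  ⋃ i : Fin 3, (fun t : ℝ => 3 * t - ((i : ℕ) : ℝ)) ⁻¹' (T i ∩ Ico 0 1)

theorem measurableSet_glueThirds {T : Fin 3 → Set ℝ} (hT : ∀ i, MeasurableSet (T i)) :
    MeasurableSet (glueThirds T) :=
  MeasurableSet.iUnion fun i =>
    ((hT i).inter measurableSet_Ico).preimage (by fun_prop)

/-- Half-open thirds are disjoint, so the index `i` can be recovered. -/
theorem mem_glueThirds_iff {T : Fin 3 → Set ℝ} {t : ℝ} (ht : t ∈ Ico (0 : ℝ) 1) (i : Fin 3) :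
    (t + ((i : ℕ) : ℝ)) / 3 ∈ glueThirds T ↔ t ∈ T i := by
  have h : ∀ k : Fin 3, 3 * ((t + ((i : ℕ) : ℝ)) / 3) - ((k : ℕ) : ℝ)
      = t + ((i : ℕ) : ℝ) - ((k : ℕ) : ℝ) := fun k => by ring
  simp only [glueThirds, mem_iUnion, mem_preimage, h]
  constructor
  · rintro ⟨k, hk, h0, h1⟩
    have h2 : ((k : ℕ) : ℝ) < ((i : ℕ) : ℝ) + 1 := by linarith [ht.2]
    have h3 : ((i : ℕ) : ℝ) < ((k : ℕ) : ℝ) + 1 := by linarith [ht.1]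
    have h2' : (k : ℕ) < (i : ℕ) + 1 := by exact_mod_cast h2
    have h3' : (i : ℕ) < (k : ℕ) + 1 := by exact_mod_cast h3
    obtain rfl : k = i := Fin.ext (by omega)
    simpa using hk
  · intro hi
    exact ⟨i, by simpa using ⟨hi, ht⟩⟩

/-- Arbitrary coefficients `a`, `b` let the induction absorb the weights: separate with `a * p i`,
`b * q i` in each third and glue. Square roots multiply, so each level contributes a factor `∑ √(p i
* q i)`. At level zero, `min a b ≤ √(a * b)`. -/
theorem IsTernarySubinvariant.exists_separating {μ ν : Measure ℝ} [IsFiniteMeasure μ]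
    [IsFiniteMeasure ν] {p q : Fin 3 → ℝ≥0} (hμ : IsTernarySubinvariant μ p)
    (hν : IsTernarySubinvariant ν q) (hμ1 : μ (Ico 0 1)ᶜ = 0) (hν1 : ν (Ico 0 1)ᶜ = 0)
    (n : ℕ) (a b : ℝ≥0) :
    ∃ T : Set ℝ, MeasurableSet T ∧ a * μ T + b * ν Tᶜ ≤
      max (μ univ) (ν univ) * ((∑ i, NNReal.sqrt (p i * q i)) ^ n * NNReal.sqrt (a * b) : ℝ≥0) := by
  induction n generalizing a b with
  | zero =>
    rcases le_total a b with h | h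
    · refine ⟨univ, MeasurableSet.univ, ?_⟩
      have : a ≤ NNReal.sqrt (a * b) := NNReal.le_sqrt_iff_sq_le.2 (by rw [sq]; gcongr)
      rw [compl_univ, measure_empty, mul_zero, add_zero, pow_zero, one_mul, mul_comm]
      gcongr
      exact le_max_left _ _
    · refine ⟨∅, MeasurableSet.empty, ?_⟩
      have : b ≤ NNReal.sqrt (a * b) := NNReal.le_sqrt_iff_sq_le.2 (by rw [sq]; gcongr)
      rw [compl_empty, measure_empty, mul_zero, zero_add, pow_zero, one_mul, mul_comm]
      gcongr
      exact le_max_right _ _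
  | succ n ih =>
    choose T hTm hT using fun i => ih (a * p i) (b * q i)
    refine ⟨glueThirds T, measurableSet_glueThirds hTm, ?_⟩
    have hae : ∀ κ : Measure ℝ, κ (Ico 0 1)ᶜ = 0 → ∀ᵐ t ∂κ, t ∈ Ico (0 : ℝ) 1 := fun κ h => h
    have h1 : ∀ i : Fin 3, μ ((fun t : ℝ => (t + ((i : ℕ) : ℝ)) / 3) ⁻¹' glueThirds T) ≤ μ (T i) := by
      intro i
      refine measure_mono_ae ?_
      filter_upwards [hae μ hμ1] with t ht h
      exact (mem_glueThirds_iff ht i).1 h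
    have h2 : ∀ i : Fin 3, ν ((fun t : ℝ => (t + ((i : ℕ) : ℝ)) / 3) ⁻¹' (glueThirds T)ᶜ) ≤ ν (T i)ᶜ := by
      intro i
      refine measure_mono_ae ?_
      filter_upwards [hae ν hν1] with t ht h hti
      exact h ((mem_glueThirds_iff ht i).2 hti)
    calc a * μ (glueThirds T) + b * ν (glueThirds T)ᶜ
        ≤ a * ∑ i, p i * μ (T i) + b * ∑ i, q i * ν (T i)ᶜ := by
          gcongr
          · exact (hμ _ (measurableSet_glueThirds hTm)).trans
              (Finset.sum_le_sum fun i _ => mul_le_mul_right (h1 i) _)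
          · exact (hν _ (measurableSet_glueThirds hTm).compl).trans
              (Finset.sum_le_sum fun i _ => mul_le_mul_right (h2 i) _)
      _ = ∑ i, (((a * p i : ℝ≥0) : ℝ≥0∞) * μ (T i) + ((b * q i : ℝ≥0) : ℝ≥0∞) * ν (T i)ᶜ) := by
          rw [Finset.mul_sum, Finset.mul_sum, ← Finset.sum_add_distrib]
          simp only [ENNReal.coe_mul, mul_assoc]
      _ ≤ ∑ i, max (μ univ) (ν univ) * ((∑ i, NNReal.sqrt (p i * q i)) ^ n *
            NNReal.sqrt (a * p i * (b * q i)) : ℝ≥0) := Finset.sum_le_sum fun i _ => hT i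
      _ = _ := by
          rw [← Finset.mul_sum, ← ENNReal.ofNNReal_finsetSum, ← Finset.mul_sum]
          have h3 : ∀ i, NNReal.sqrt (a * p i * (b * q i))
              = NNReal.sqrt (p i * q i) * NNReal.sqrt (a * b) := fun i => by
            rw [← NNReal.sqrt_mul]
            congr 1
            ring
          simp only [h3]
          rw [← Finset.sum_mul, pow_succ, mul_assoc]

/-- The measure `μ ⊓ ν` has mass at most `μ T + ν Tᶜ` for every `T`, and this can be made
arbitrarily small. -/
theorem IsTernarySubinvariant.mutuallySingular {μ ν : Measure ℝ} [IsFiniteMeasure μ]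
    [IsFiniteMeasure ν] {p q : Fin 3 → ℝ≥0} (hμ : IsTernarySubinvariant μ p)
    (hν : IsTernarySubinvariant ν q) (hμ1 : μ (Ico 0 1)ᶜ = 0) (hν1 : ν (Ico 0 1)ᶜ = 0)
    (hpq : ∑ i, NNReal.sqrt (p i * q i) < 1) : μ.MutuallySingular ν := by
  refine Measure.mutuallySingular_of_disjoint (disjoint_iff_inf_le.2 ?_)
  set ξ := μ ⊓ ν
  have hlim : Tendsto (fun n : ℕ => max (μ univ) (ν univ) *
      (((∑ i, NNReal.sqrt (p i * q i)) ^ n : ℝ≥0) : ℝ≥0∞)) atTop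
      (𝓝 (max (μ univ) (ν univ) * ((0 : ℝ≥0) : ℝ≥0∞))) :=
    ENNReal.Tendsto.const_mul
      (ENNReal.tendsto_coe.2 (tendsto_pow_atTop_nhds_zero_of_lt_one zero_le hpq))
      (Or.inr (max_lt (measure_lt_top _ _) (measure_lt_top _ _)).ne)
  have h0 : ξ univ ≤ 0 := by
    refine (ge_of_tendsto' hlim fun n => ?_).trans (by simp)
    obtain ⟨T, -, hT⟩ := hμ.exists_separating hν hμ1 hν1 n 1 1
    calc ξ univ ≤ ξ T + ξ Tᶜ := by
          rw [← union_compl_self T]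
          exact measure_union_le _ _
      _ ≤ μ T + ν Tᶜ := add_le_add ((inf_le_left : μ ⊓ ν ≤ μ) T) ((inf_le_right : μ ⊓ ν ≤ ν) Tᶜ)
      _ ≤ _ := by simpa using hT
  exact (Measure.measure_univ_eq_zero.1 (le_antisymm h0 bot_le)).le

theorem isTernarySubinvariant_volume :
    IsTernarySubinvariant (volume.restrict (Icc (0 : ℝ) 1)) fun _ => 3⁻¹ := by
  intro A hA
  have hmeas : ∀ i : Fin 3, Measurable fun t : ℝ => (t + ((i : ℕ) : ℝ)) / 3 := fun i => by fun_prop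
  have hsub : A ∩ Icc 0 1 ⊆ ⋃ i : Fin 3, (fun t : ℝ => (t + ((i : ℕ) : ℝ)) / 3) ''
      ((fun t : ℝ => (t + ((i : ℕ) : ℝ)) / 3) ⁻¹' A ∩ Icc 0 1) := by
    rintro t ⟨htA, ht0, ht1⟩
    have key : ∀ i : Fin 3, 3 * t - ((i : ℕ) : ℝ) ∈ Icc (0 : ℝ) 1 →
        t ∈ (fun t : ℝ => (t + ((i : ℕ) : ℝ)) / 3) ''
          ((fun t : ℝ => (t + ((i : ℕ) : ℝ)) / 3) ⁻¹' A ∩ Icc 0 1) := by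
      intro i hi
      have h : (3 * t - ((i : ℕ) : ℝ) + ((i : ℕ) : ℝ)) / 3 = t := by ring
      exact ⟨3 * t - ((i : ℕ) : ℝ), ⟨by rwa [mem_preimage, h], hi⟩, h⟩
    rw [mem_iUnion]
    rcases le_total (3 * t) 1 with h | h
    · exact ⟨0, key 0 ⟨by simp; linarith, by simpa using h⟩⟩
    rcases le_total (3 * t) 2 with h' | h'
    · exact ⟨1, key 1 ⟨by simpa using h, by simp; linarith⟩⟩
    · exact ⟨2, key 2 ⟨by simpa using h', by simp; linarith⟩⟩
  rw [Measure.restrict_apply hA]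
  refine (measure_mono hsub).trans ((measure_iUnion_le _).trans ?_)
  rw [tsum_fintype]
  refine Finset.sum_le_sum fun i _ => ?_
  rw [Measure.restrict_apply (hmeas i hA), ← hausdorffMeasure_real]
  have hl : LipschitzWith 3⁻¹ fun t : ℝ => (t + ((i : ℕ) : ℝ)) / 3 :=
    LipschitzWith.of_dist_le_mul fun x y => by
      rw [Real.dist_eq, Real.dist_eq, ← sub_div, add_sub_add_right_eq_sub, abs_div]
      norm_num
      rw [div_eq_inv_mul]
      norm_num
  refine (hl.hausdorffMeasure_image_le zero_le_one _).trans (by simp)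

/-- The distribution of a coordinate under the Hausdorff measure on the carpet. -/
def carpetMarginal (j : Fin 2) : Measure ℝ :=
  (μH[carpetDim].restrict carpet).map fun x : EuclideanSpace ℝ (Fin 2) => x j

theorem measurable_coordinate (j : Fin 2) :
    Measurable fun x : EuclideanSpace ℝ (Fin 2) => x j := by fun_prop

theorem carpetMarginal_apply (j : Fin 2) {A : Set ℝ} (hA : MeasurableSet A) :
    carpetMarginal j A = μH[carpetDim] ({x | x j ∈ A} ∩ carpet) := by
  rw [carpetMarginal, Measure.map_apply (measurable_coordinate j) hA,
    Measure.restrict_apply (measurable_coordinate j hA)]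
  rfl

instance (j : Fin 2) : IsFiniteMeasure (carpetMarginal j) :=
  ⟨by
    rw [carpetMarginal_apply j MeasurableSet.univ]
    exact (measure_mono inter_subset_right).trans_lt hausdorffMeasure_carpet_lt_top⟩

/-- The fraction of the kept cells that lie in a given column or row. -/
def columnWeight : Fin 3 → ℝ≥0 := ![3 / 8, 2 / 8, 3 / 8]

theorem isTernarySubinvariant_carpetMarginal (j : Fin 2) :
    IsTernarySubinvariant (carpetMarginal j) columnWeight := by
  intro A hA
  have hg : ∀ i : Fin 3, MeasurableSet ((fun t : ℝ => (t + ((i : ℕ) : ℝ)) / 3) ⁻¹' A) :=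
    fun i => hA.preimage (by fun_prop)
  have hsub : {x : EuclideanSpace ℝ (Fin 2) | x j ∈ A} ∩ carpet ⊆ ⋃ a ∈ keptCells,
      carpetMap a '' ({x | x j ∈ (fun t : ℝ => (t + ((digit a j : ℕ) : ℝ)) / 3) ⁻¹' A} ∩ carpet) := by
    rintro x ⟨hxA, hx⟩
    obtain ⟨a, ha, y, hy, rfl⟩ := exists_carpetMap_eq hx
    refine mem_biUnion (x := a) (mem_keptCells.2 ha) (mem_image_of_mem _ ⟨?_, hy⟩)
    rw [mem_ofPred_eq, carpetMap_apply] at hxA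
    exact hxA
  have hcell : ∀ a : Fin 3 × Fin 3,
      μH[carpetDim] (carpetMap a '' ({x | x j ∈ (fun t : ℝ => (t + ((digit a j : ℕ) : ℝ)) / 3) ⁻¹' A}
        ∩ carpet)) ≤ 8⁻¹ * carpetMarginal j ((fun t : ℝ => (t + ((digit a j : ℕ) : ℝ)) / 3) ⁻¹' A) := by
    intro a
    have hl : LipschitzWith 3⁻¹ (carpetMap a) :=
      LipschitzWith.of_dist_le_mul fun x y => by rw [dist_carpetMap]; simp
    rw [carpetMarginal_apply j (hg _)]
    refine (hl.hausdorffMeasure_image_le carpetDim_pos.le _).trans (le_of_eq ?_)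
    have h8 := ennreal_three_inv_pow_rpow_carpetDim 1
    rw [pow_one, pow_one] at h8
    rw [ENNReal.coe_inv (by simp), ENNReal.coe_ofNat, h8]
  rw [carpetMarginal_apply j hA]
  calc _ ≤ ∑ a ∈ keptCells,
        8⁻¹ * carpetMarginal j ((fun t : ℝ => (t + ((digit a j : ℕ) : ℝ)) / 3) ⁻¹' A) :=
        (measure_mono hsub).trans ((measure_biUnion_finset_le _ _).trans
          (Finset.sum_le_sum fun a _ => hcell a))
    _ = ∑ i : Fin 3, ∑ a ∈ keptCells with digit a j = i,
        8⁻¹ * carpetMarginal j ((fun t : ℝ => (t + ((digit a j : ℕ) : ℝ)) / 3) ⁻¹' A) :=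
        (Finset.sum_fiberwise _ _ _).symm
    _ ≤ _ := by
        refine Finset.sum_le_sum fun i _ => ?_
        have hconst : ∀ a ∈ keptCells.filter (fun a => digit a j = i),
            8⁻¹ * carpetMarginal j ((fun t : ℝ => (t + ((digit a j : ℕ) : ℝ)) / 3) ⁻¹' A)
            = 8⁻¹ * carpetMarginal j ((fun t : ℝ => (t + ((i : ℕ) : ℝ)) / 3) ⁻¹' A) := by
          intro a ha
          rw [(Finset.mem_filter.1 ha).2]
        have hcard : ∀ (j : Fin 2) (i : Fin 3),
            (keptCells.filter (fun a => digit a j = i)).card = ![3, 2, 3] i := by decide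
        rw [Finset.sum_congr rfl hconst, Finset.sum_const, hcard, nsmul_eq_mul, ← mul_assoc]
        gcongr
        have h8 : ∀ m : ℕ, (((m / 8 : ℝ≥0)) : ℝ≥0∞) = (m : ℝ≥0∞) * 8⁻¹ := fun m => by
          rw [ENNReal.coe_div (by simp), div_eq_mul_inv]
          simp
        fin_cases i
        · exact (h8 3).ge
        · exact (h8 2).ge
        · exact (h8 3).ge

theorem carpetMarginal_compl_Icc (j : Fin 2) : carpetMarginal j (Icc 0 1)ᶜ = 0 := by
  rw [carpetMarginal_apply j measurableSet_Icc.compl]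
  convert! measure_empty (μ := μH[carpetDim])
  ext x
  simp only [mem_inter_iff, mem_empty_iff_false, iff_false]
  exact fun h => h.1 (mem_Icc_of_mem_carpet h.2 j)

/-- The preimages of 1 are 3, 2 and 1, of which only the last lies in `[0, 1]`; so the finite mass
`m` of the point satisfies `m ≤ 3 / 8 * m`. -/
theorem carpetMarginal_singleton_one (j : Fin 2) : carpetMarginal j {1} = 0 := by
  have h := isTernarySubinvariant_carpetMarginal j {1} (measurableSet_singleton _)
  have hpre : ∀ i : Fin 3, (fun t : ℝ => (t + ((i : ℕ) : ℝ)) / 3) ⁻¹' {1}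
      = {3 - ((i : ℕ) : ℝ)} := by
    intro i
    ext t
    simp only [mem_preimage, mem_singleton_iff]
    constructor <;> intro h <;> linarith
  have hzero : ∀ t : ℝ, 1 < t → carpetMarginal j {t} = 0 := fun t ht =>
    measure_mono_null (singleton_subset_iff.2 fun h => h.2.not_gt ht) (carpetMarginal_compl_Icc j)
  simp only [hpre, Fin.sum_univ_three] at h
  norm_num [columnWeight] at h
  rw [hzero 3 (by norm_num), hzero 2 (by norm_num)] at h
  norm_num at h
  by_contra hne
  have hlt : ((3 / 8 : ℝ≥0) : ℝ≥0∞) * carpetMarginal j {1} < 1 * carpetMarginal j {1} :=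
    ENNReal.mul_lt_mul_left hne (measure_ne_top _ _)
      (by rw [← ENNReal.coe_one, ENNReal.coe_lt_coe, ← NNReal.coe_lt_coe]; norm_num)
  rw [one_mul] at hlt
  exact hlt.not_ge (by simpa using h)

theorem carpetMarginal_mutuallySingular (j : Fin 2) :
    (carpetMarginal j).MutuallySingular (volume.restrict (Icc (0 : ℝ) 1)) := by
  have hcompl : ((Ico 0 1)ᶜ : Set ℝ) = (Icc 0 1)ᶜ ∪ {1} := by
    ext t
    simp only [mem_compl_iff, mem_Ico, mem_Icc, mem_union, mem_singleton_iff, not_and, not_lt, not_le]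
    constructor
    · intro h
      by_cases h1 : t = 1
      · exact Or.inr h1
      · exact Or.inl fun h0 => lt_of_le_of_ne (h h0) (Ne.symm h1)
    · rintro (h | rfl) h0
      · exact (h h0).le
      · exact le_rfl
  refine (isTernarySubinvariant_carpetMarginal j).mutuallySingular isTernarySubinvariant_volume
    ?_ ?_ ?_
  · rw [hcompl]
    exact measure_union_null (carpetMarginal_compl_Icc j) (carpetMarginal_singleton_one j)
  · rw [hcompl]
    refine measure_union_null ?_ (by simp)
    rw [Measure.restrict_apply measurableSet_Icc.compl, compl_inter_self, measure_empty]
  -- Rational upper bounds for `√(1/8)` and `√(1/12)`, with 0.354 + 0.289 + 0.354 = 0.997 < 1.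
  · have h1 : NNReal.sqrt (3 / 8 * 3⁻¹) ≤ 354 / 1000 := by
      rw [NNReal.sqrt_le_iff_le_sq, ← NNReal.coe_le_coe]
      norm_num
    have h2 : NNReal.sqrt (2 / 8 * 3⁻¹) ≤ 289 / 1000 := by
      rw [NNReal.sqrt_le_iff_le_sq, ← NNReal.coe_le_coe]
      norm_num
    rw [Fin.sum_univ_three]
    refine lt_of_le_of_lt (add_le_add (add_le_add h1 h2) h1) ?_
    rw [← NNReal.coe_lt_coe]
    norm_num

/-! ## The normalized measure on the carpet -/

instance : CompactSpace carpet := isCompact_iff_compactSpace.1 isCompact_carpet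

theorem carpetMeasure_eq : carpetMeasure =
    (μH[carpetDim] (univ : Set carpet))⁻¹ • (μH[carpetDim] : Measure carpet) := rfl

theorem hausdorffMeasure_subtype (A : Set carpet) :
    μH[carpetDim] A = μH[carpetDim] (Subtype.val '' A) :=
  (isometry_subtype_coe.hausdorffMeasure_image (Or.inl carpetDim_pos.le) A).symm

theorem hausdorffMeasure_univ_carpet :
    μH[carpetDim] (univ : Set carpet) = μH[carpetDim] carpet := by
  rw [hausdorffMeasure_subtype, image_univ, Subtype.range_coe]

theorem isProbabilityMeasure_carpetMeasure : IsProbabilityMeasure carpetMeasure := by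
  constructor
  rw [carpetMeasure_eq, Measure.smul_apply, smul_eq_mul, hausdorffMeasure_univ_carpet]
  exact ENNReal.inv_mul_cancel hausdorffMeasure_carpet_pos.ne' hausdorffMeasure_carpet_lt_top.ne

instance : IsProbabilityMeasure carpetMeasure := isProbabilityMeasure_carpetMeasure

theorem carpetMeasure_ball_pos (x : carpet) {r : ℝ} (hr : 0 < r) :
    0 < carpetMeasure (Metric.ball x r) := by
  have h : Subtype.val '' Metric.ball x r = carpet ∩ Metric.ball (x : EuclideanSpace ℝ (Fin 2)) r := by
    ext y
    constructor
    · rintro ⟨z, hz, rfl⟩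
      exact ⟨z.2, hz⟩
    · rintro ⟨hy, hyb⟩
      exact ⟨⟨y, hy⟩, hyb, rfl⟩
  rw [carpetMeasure_eq, Measure.smul_apply, smul_eq_mul, hausdorffMeasure_univ_carpet,
    hausdorffMeasure_subtype, h]
  exact ENNReal.mul_pos (ENNReal.inv_ne_zero.2 hausdorffMeasure_carpet_lt_top.ne)
    (hausdorffMeasure_carpet_inter_ball_pos x.2 hr).ne'

instance : carpetMeasure.IsOpenPosMeasure := by
  refine ⟨fun U hU ⟨x, hx⟩ => ?_⟩
  obtain ⟨r, hr, hrU⟩ := Metric.isOpen_iff.1 hU x hx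
  exact ((carpetMeasure_ball_pos x hr).trans_le (measure_mono hrU)).ne'

theorem carpetMeasure_countable {A : Set carpet} (hA : A.Countable) : carpetMeasure A = 0 := by
  have := Measure.nullSingletonClass_hausdorff carpet carpetDim_pos
  rw [carpetMeasure_eq, Measure.smul_apply, hA.measure_zero, smul_zero]

theorem map_carpetMeasure (j : Fin 2) : carpetMeasure.map (fun x : carpet => x.1 j) =
    (μH[carpetDim] (univ : Set carpet))⁻¹ • carpetMarginal j := by
  have h := (isometry_subtype_coe (s := carpet)).map_hausdorffMeasure (Or.inl carpetDim_pos.le)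
  rw [Subtype.range_coe] at h
  rw [carpetMarginal, ← h, Measure.map_map (measurable_coordinate j) measurable_subtype_coe,
    carpetMeasure_eq, Measure.map_smul]
  rfl

theorem map_carpetMeasure_mutuallySingular (j : Fin 2) :
    (carpetMeasure.map (fun x : carpet => x.1 j)).MutuallySingular
      (volume.restrict (Icc (0 : ℝ) 1)) := by
  rw [map_carpetMeasure]
  exact (carpetMarginal_mutuallySingular j).smul _

/-! ## Curves in the carpet -/

/-- A null set of the line for the `j`-th marginal of the carpet, of full Lebesgue measure in the
unit interval. -/
def singularSet (j : Fin 2) : Set ℝ := (map_carpetMeasure_mutuallySingular j).nullSet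

theorem measurableSet_singularSet (j : Fin 2) : MeasurableSet (singularSet j) :=
  (map_carpetMeasure_mutuallySingular j).measurableSet_nullSet

/-- The points of the carpet with a coordinate in the exceptional set. -/
def blockingSet : Set carpet := ⋃ j : Fin 2, (fun x : carpet => x.1 j) ⁻¹' singularSet j

theorem measurable_carpet_coordinate (j : Fin 2) : Measurable fun x : carpet => x.1 j :=
  (measurable_coordinate j).comp measurable_subtype_coe

theorem measurableSet_blockingSet : MeasurableSet blockingSet :=
  MeasurableSet.iUnion fun j => measurable_carpet_coordinate j (measurableSet_singularSet j)

theorem carpetMeasure_blockingSet : carpetMeasure blockingSet = 0 := by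
  refine measure_iUnion_null fun j => ?_
  rw [← Measure.map_apply (measurable_carpet_coordinate j) (measurableSet_singularSet j)]
  exact (map_carpetMeasure_mutuallySingular j).measure_nullSet

theorem RectifiableCurve.lipschitzOnWith {P : Type*} [MetricSpace P] (γ : RectifiableCurve P) :
    LipschitzOnWith 1 γ.toFun (Icc 0 γ.len) := by
  have key : ∀ x ∈ Icc 0 γ.len, ∀ y ∈ Icc 0 γ.len, x ≤ y →
      edist (γ.toFun x) (γ.toFun y) ≤ edist x y := by
    intro x hx y hy hxy
    refine (eVariationOn.edist_le γ.toFun (s := Icc 0 γ.len ∩ Icc x y) ⟨hx, left_mem_Icc.2 hxy⟩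
      ⟨hy, right_mem_Icc.2 hxy⟩).trans ?_
    rw [γ.unitSpeed hx hy, edist_comm, edist_dist, Real.dist_eq, abs_of_nonneg (sub_nonneg.2 hxy)]
    simp
  intro x hx y hy
  rw [ENNReal.coe_one, one_mul]
  rcases le_total x y with h | h
  · exact key x hx y hy h
  · rw [edist_comm, edist_comm x]
    exact key y hy x hx h

theorem RectifiableCurve.exists_ne {P : Type*} [MetricSpace P] (γ : RectifiableCurve P) :
    ∃ t ∈ Icc 0 γ.len, γ.toFun 0 ≠ γ.toFun t := by
  by_contra! h
  have h1 := γ.unitSpeed (left_mem_Icc.2 γ.len_pos.le) (right_mem_Icc.2 γ.len_pos.le)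
  have h2 : eVariationOn γ.toFun (Icc 0 γ.len ∩ Icc 0 γ.len) = 0 := by
    rw [inter_self]
    refine eVariationOn.constant_on ?_
    rintro _ ⟨s, hs, rfl⟩ _ ⟨t, ht, rfl⟩
    exact (h s hs).symm.trans (h t ht)
  rw [h2] at h1
  have := γ.len_pos
  simp at h1
  linarith

/-- The function that blocks all curves in the carpet. -/
def blockingDensity : carpet → ℝ≥0∞ := blockingSet.indicator fun _ => ⊤

theorem measurable_blockingDensity : Measurable blockingDensity :=
  measurable_const.indicator measurableSet_blockingSet

theorem integral_blockingDensity (γ : RectifiableCurve carpet) :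
    γ.integral blockingDensity = ⊤ := by
  by_contra hne
  obtain ⟨t, ht, hγt⟩ := γ.exists_ne
  have hcont : ContinuousOn γ.toFun (Icc 0 γ.len) := γ.lipschitzOnWith.continuousOn
  -- A finite integral of a density equal to `∞` on the blocking set leaves only a null set of times
  -- there.
  have hae : ∀ᵐ s, s ∈ Icc 0 γ.len → γ.toFun s ∉ blockingSet := by
    have h := ae_lt_top' (measurable_blockingDensity.comp_aemeasurable
      (hcont.aemeasurable measurableSet_Icc)) hne
    rw [ae_restrict_iff' measurableSet_Icc] at h
    filter_upwards [h] with s hs hsI hmem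
    have := hs hsI
    simp [blockingDensity, hmem] at this
  obtain ⟨j, hj⟩ : ∃ j, (γ.toFun 0).1 j ≠ (γ.toFun t).1 j := by
    by_contra! h
    exact hγt (Subtype.ext (PiLp.ext h))
  set f : ℝ → ℝ := fun s => (γ.toFun s).1 j
  have hf : LipschitzOnWith 1 f (Icc 0 γ.len) := by
    intro x hx y hy
    refine le_trans ?_ (γ.lipschitzOnWith hx hy)
    rw [Subtype.edist_eq]
    exact PiLp.edist_apply_le (γ.toFun x).1 (γ.toFun y).1 j
  -- By the intermediate value theorem every value between is attained, and a value in `singularSet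
  -- j` is attained inside the blocking set.
  have hsub : uIcc (f 0) (f t) ∩ singularSet j ⊆
      f '' (Icc 0 γ.len ∩ {s | γ.toFun s ∈ blockingSet}) := by
    rintro y ⟨hy, hyS⟩
    have hI : uIcc 0 t ⊆ Icc 0 γ.len := by
      rw [uIcc_of_le ht.1]
      exact Icc_subset_Icc_right ht.2
    obtain ⟨s, hs, rfl⟩ := intermediate_value_uIcc (hf.continuousOn.mono hI) hy
    exact ⟨s, ⟨hI hs, mem_iUnion.2 ⟨j, hyS⟩⟩, rfl⟩
  have hnull : volume (uIcc (f 0) (f t) ∩ singularSet j) = 0 := by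
    refine measure_mono_null hsub ?_
    have h := (hf.mono inter_subset_left).hausdorffMeasure_image_le zero_le_one
      (s := Icc 0 γ.len ∩ {s | γ.toFun s ∈ blockingSet})
    rw [hausdorffMeasure_real] at h
    refine le_antisymm (h.trans (le_of_eq ?_)) bot_le
    have h0 : volume (Icc 0 γ.len ∩ {s | γ.toFun s ∈ blockingSet}) = 0 := by
      refine measure_mono_null ?_ (ae_iff.1 hae)
      intro s hs h
      exact h hs.1 hs.2
    rw [h0, mul_zero]
  have hnull' : volume (uIcc (f 0) (f t) ∩ (singularSet j)ᶜ) = 0 := by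
    have h : volume.restrict (Icc (0 : ℝ) 1) (singularSet j)ᶜ = 0 :=
      (map_carpetMeasure_mutuallySingular j).measure_compl_nullSet
    rw [Measure.restrict_apply (measurableSet_singularSet j).compl] at h
    have hI : uIcc (f 0) (f t) ⊆ Icc 0 1 := uIcc_subset_Icc
      (mem_Icc_of_mem_carpet (γ.toFun 0).2 j) (mem_Icc_of_mem_carpet (γ.toFun t).2 j)
    rw [inter_comm]
    exact measure_mono_null (inter_subset_inter_right _ hI) h
  have hzero : volume (uIcc (f 0) (f t)) = 0 := by
    rw [← inter_union_compl (uIcc (f 0) (f t)) (singularSet j)]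
    exact measure_union_null hnull hnull'
  rw [Real.volume_interval, ENNReal.ofReal_eq_zero] at hzero
  exact hj (sub_eq_zero.1 (abs_nonpos_iff.1 hzero)).symm

/-! ## Newtonian spaces on the carpet -/

theorem blockingDensity_ae_eq_zero :
    (fun x => (blockingDensity x : EReal)) =ᵐ[carpetMeasure] 0 := by
  filter_upwards [measure_eq_zero_iff_ae_notMem.1 carpetMeasure_blockingSet] with x hx
  simp [blockingDensity, hx]

theorem norm_blockingDensity (X : QuasiBanachFunctionLattice carpetMeasure) :
    X.norm (fun x => (blockingDensity x : EReal)) = 0 :=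
  (X.norm_eq_zero_iff _ measurable_blockingDensity.coe_ereal_ennreal.aemeasurable).2
    blockingDensity_ae_eq_zero

theorem zeroModulus_univ (X : QuasiBanachFunctionLattice carpetMeasure) :
    ZeroModulus X (univ : Set (RectifiableCurve carpet)) := by
  refine ⟨blockingDensity, measurable_blockingDensity,
    ⟨measurable_blockingDensity.coe_ereal_ennreal.aemeasurable, ?_⟩,
    fun γ _ => integral_blockingDensity γ⟩
  rw [norm_blockingDensity]
  exact ENNReal.zero_lt_top

/-- Infinite curve integrals dominate any oscillation, including the conventional `|∞ - ∞| = ∞`, so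
the blocking density is an upper gradient of every `u`. -/
theorem newtonNorm_eq (X : QuasiBanachFunctionLattice carpetMeasure) (u : carpet → EReal) :
    newtonNorm X u = X.norm u := by
  have h : ⨅ (g : carpet → ℝ≥0∞) (_ : IsUpperGradient u g), X.norm (fun x => (g x : EReal)) = 0 := by
    refine le_antisymm ((iInf₂_le blockingDensity ⟨measurable_blockingDensity, fun γ => ?_⟩).trans
      (norm_blockingDensity X).le) bot_le
    rw [integral_blockingDensity]
    exact le_top
  rw [newtonNorm, h, add_zero]

theorem newtonSpace_eq (X : QuasiBanachFunctionLattice carpetMeasure) :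
    newtonSpace X = X.functions := by
  ext u
  rw [newtonSpace, mem_ofPred_eq, newtonNorm_eq]
  exact ⟨fun h => h.1, fun h => ⟨h, h.2⟩⟩

/-! ## Capacity and quasicontinuity for bounded functions -/

theorem indicator_one_mem_functions {A : Set carpet} (hA : MeasurableSet A) :
    A.indicator (fun _ => (1 : EReal)) ∈ (LInfty carpetMeasure).functions := by
  refine ⟨(measurable_const.indicator hA).aemeasurable, ?_⟩
  refine lt_of_le_of_lt (essSup_le_of_ae_le 1 (Eventually.of_forall fun x => ?_)) ENNReal.one_lt_top
  by_cases hx : x ∈ A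
  · simp only [indicator_of_mem hx]
    rw [← EReal.coe_one, EReal.abs_def]
    simp
  · simp [hx]

/-- The indicator of a measurable null superset is admissible and has norm zero. -/
theorem capacity_eq_zero {E : Set carpet} (hE : carpetMeasure E = 0) :
    capacity (LInfty carpetMeasure) E = 0 := by
  have hm := measurableSet_toMeasurable carpetMeasure E
  have hmem := indicator_one_mem_functions hm
  refine le_antisymm ((iInf₂_le ((toMeasurable carpetMeasure E).indicator fun _ => (1 : EReal))
    ⟨(newtonSpace_eq _).symm ▸ hmem, fun x hx => ?_⟩).trans ?_) bot_le
  · rw [newtonNorm_eq]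
    refine le_of_eq (((LInfty carpetMeasure).norm_eq_zero_iff _ hmem.1).2 ?_)
    refine indicator_meas_zero ?_
    rw [measure_toMeasurable, hE]
  · rw [indicator_of_mem (subset_toMeasurable carpetMeasure E hx)]

theorem one_le_capacity {E : Set carpet} (hE : carpetMeasure E ≠ 0) :
    1 ≤ capacity (LInfty carpetMeasure) E := by
  refine le_iInf₂ fun u hu => ?_
  rw [newtonNorm_eq]
  by_contra! hlt
  refine hE (measure_mono_null (fun x hx => ?_)
    (ae_iff.1 (ENNReal.ae_le_essSup (μ := carpetMeasure) fun x => (u x).abs)))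
  refine not_le.2 (lt_of_lt_of_le hlt ?_)
  have h1 := hu.2 x hx
  generalize u x = y at h1
  induction y with
  | bot => exact absurd (le_bot_iff.1 h1) (EReal.coe_ne_bot 1)
  | top => simp
  | coe y =>
    rw [EReal.abs_def]
    have h1' : 1 ≤ y := by exact_mod_cast h1
    exact ENNReal.one_le_ofReal.2 (h1'.trans (le_abs_self y))

theorem measure_eq_zero_of_capacity_lt_one {E : Set carpet}
    (hE : capacity (LInfty carpetMeasure) E < 1) : carpetMeasure E = 0 := by
  by_contra h
  exact (one_le_capacity h).not_gt hE

theorem eq_empty_of_isOpen_of_capacity_lt_one {G : Set carpet} (hG : IsOpen G)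
    (h : capacity (LInfty carpetMeasure) G < 1) : G = ∅ :=
  hG.eq_empty_of_measure_zero (measure_eq_zero_of_capacity_lt_one h)

theorem Quasicontinuous.realContinuousOn_univ {u : carpet → EReal}
    (hu : Quasicontinuous (LInfty carpetMeasure) u) : RealContinuousOn u univ := by
  obtain ⟨G, hG, hGc, hu⟩ := hu 1 one_pos
  rwa [eq_empty_of_isOpen_of_capacity_lt_one hG hGc, compl_empty] at hu

theorem weaklyQuasicontinuous_of_null {u : carpet → EReal} {E : Set carpet}
    (hE : carpetMeasure E = 0) (hu : RealContinuousOn u Eᶜ) :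
    WeaklyQuasicontinuous (LInfty carpetMeasure) u :=
  fun ε hε => ⟨E, by rwa [capacity_eq_zero hE], hu⟩

theorem Quasicontinuous.weaklyQuasicontinuous {u : carpet → EReal}
    (hu : Quasicontinuous (LInfty carpetMeasure) u) :
    WeaklyQuasicontinuous (LInfty carpetMeasure) u :=
  weaklyQuasicontinuous_of_null measure_empty (by simpa using hu.realContinuousOn_univ)

/-- Continuity off a null set `E` at a point of `K` outside `E` gives a neighbourhood `U` with `U \
K ⊆ E`. This difference is open and null, hence empty, so `K` would have an interior point. -/
theorem not_weaklyQuasicontinuous_indicator {K : Set carpet} (hK : IsClosed K)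
    (hKi : interior K = ∅) (hKm : carpetMeasure K ≠ 0) :
    ¬ WeaklyQuasicontinuous (LInfty carpetMeasure) (K.indicator fun _ => (1 : EReal)) := by
  intro h
  obtain ⟨E, hE, hcont, -⟩ := h 1 one_pos
  have hE0 := measure_eq_zero_of_capacity_lt_one hE
  obtain ⟨x, hxK, hxE⟩ : ∃ x ∈ K, x ∉ E := by
    by_contra! hsub
    exact hKm (measure_mono_null hsub hE0)
  have hx := (hcont x hxE).eventually (lt_mem_nhds (a := 0) (by simp [hxK]))
  rw [eventually_nhdsWithin_iff, eventually_nhds_iff] at hx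
  obtain ⟨U, hU, hUo, hxU⟩ := hx
  have hdiff : U \ K ⊆ E := by
    intro y hy
    by_contra hyE
    have := hU y hy.1 hyE
    simp [hy.2] at this
  have hempty := (hUo.sdiff hK).eq_empty_of_measure_zero (measure_mono_null hdiff hE0)
  have : x ∈ interior K := mem_interior.2 ⟨U, sdiff_eq_empty.1 hempty, hUo, hxU⟩
  rw [hKi] at this
  exact this

/-- Outer regularity encloses a countable dense set, which is null, in an open set of measure less
than 1; take the complement. -/
theorem exists_compact_interior_eq_empty :
    ∃ K : Set carpet, IsCompact K ∧ interior K = ∅ ∧ 0 < carpetMeasure K := by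
  obtain ⟨D, hDc, hD⟩ := TopologicalSpace.exists_countable_dense carpet
  obtain ⟨U, hDU, hUo, hU⟩ := D.exists_isOpen_lt_of_lt (μ := carpetMeasure) 1
    (by rw [carpetMeasure_countable hDc]; exact one_pos)
  refine ⟨Uᶜ, hUo.isClosed_compl.isCompact, ?_, ?_⟩
  · rw [interior_compl, (hD.mono hDU).closure_eq, compl_univ]
  · rw [prob_compl_eq_one_sub hUo.measurableSet]
    exact tsub_pos_of_lt hU

theorem not_isOpen_singleton (x : carpet) : ¬ IsOpen {x} := fun h =>
  (singleton_ne_empty x)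
    (h.eq_empty_of_measure_zero (carpetMeasure_countable (countable_singleton x)))

theorem not_propertyC : ¬ PropertyC (LInfty carpetMeasure) := by
  rintro ⟨c, -, hc⟩
  have x : carpet := ⟨carpetPoint fun _ => ⟨(0, 0), by decide⟩, carpetPoint_mem_carpet _⟩
  have h := hc {x}
  rw [capacity_eq_zero (carpetMeasure_countable (countable_singleton x)), mul_zero] at h
  have h1 : (1 : ℝ≥0∞) ≤ ⨅ (G : Set carpet) (_ : IsOpen G ∧ {x} ⊆ G),
      capacity (LInfty carpetMeasure) G :=
    le_iInf₂ fun G hG => one_le_capacity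
      (hG.1.measure_pos carpetMeasure ⟨x, hG.2 rfl⟩).ne'
  exact absurd (h1.trans h) (by simp)

theorem not_propertyD : ¬ PropertyD (LInfty carpetMeasure) := by
  intro h
  have x : carpet := ⟨carpetPoint fun _ => ⟨(0, 0), by decide⟩, carpetPoint_mem_carpet _⟩
  have hcont := (h (({x} : Set carpet).indicator fun _ => (1 : EReal))
    (weaklyQuasicontinuous_of_null (carpetMeasure_countable (countable_singleton x))
      ⟨(continuousOn_const (c := (0 : EReal))).congr fun y hy => indicator_of_notMem hy _,
        fun y hy => by rw [indicator_of_notMem hy]; simp⟩)).realContinuousOn_univ.1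
  rw [continuousOn_univ] at hcont
  refine not_isOpen_singleton x ?_
  -- Continuity of the indicator of a point would make that point isolated, though points are null.
  convert! isOpen_Ioi.preimage hcont (t := Ioi 0)
  ext y
  by_cases hy : y = x <;> simp [hy]

theorem not_propertyE : ¬ PropertyE (LInfty carpetMeasure) := by
  intro h
  have x : carpet := ⟨carpetPoint fun _ => ⟨(0, 0), by decide⟩, carpetPoint_mem_carpet _⟩
  obtain ⟨G, hG, hxG, hGc⟩ :=
    h {x} (capacity_eq_zero (carpetMeasure_countable (countable_singleton x))) 1 one_pos
  have := hxG rfl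
  rw [eq_empty_of_isOpen_of_capacity_lt_one hG hGc] at this
  exact this

theorem not_propertyB : ¬ PropertyB (LInfty carpetMeasure) :=
  fun h => not_propertyC ⟨1, le_rfl, h⟩

theorem not_propertyG : ¬ PropertyG (LInfty carpetMeasure) := by
  intro h
  obtain ⟨K, hK, hKi, hKm⟩ := exists_compact_interior_eq_empty
  refine not_weaklyQuasicontinuous_indicator hK.isClosed hKi hKm.ne' (h _ ?_)
  rw [newtonSpace_eq]
  exact indicator_one_mem_functions hK.measurableSet

theorem not_propertyA : ¬ PropertyA (LInfty carpetMeasure) :=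
  fun h => not_propertyG fun u hu => (h u hu).weaklyQuasicontinuous

theorem not_propertyF : ¬ PropertyF (LInfty carpetMeasure) := by
  refine fun h => not_propertyG fun u hu => ?_
  obtain ⟨v, hv, hvu⟩ := h u hu
  have hcont := hv.realContinuousOn_univ
  have hEq : ∀ x ∈ {x | v x ≠ u x}ᶜ, u x = v x := fun x hx => (not_not.1 hx).symm
  refine weaklyQuasicontinuous_of_null (E := {x | v x ≠ u x})
    (measure_eq_zero_of_capacity_lt_one (by rw [hvu]; exact one_pos))
    ⟨(hcont.1.mono (subset_univ _)).congr hEq, fun x hx => ?_⟩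
  rw [hEq x hx]
  exact hcont.2 x (mem_univ x)

end Newtonian

end

theorem mainTheorem9 :
    IsProbabilityMeasure carpetMeasure ∧
    (∀ (x : carpet) (r : ℝ), 0 < r → 0 < carpetMeasure (Metric.ball x r)) ∧
    (carpetMeasure.map (fun x : carpet => x.1 0)).MutuallySingular
      (volume.restrict (Icc (0 : ℝ) 1)) ∧
    (∀ X : QuasiBanachFunctionLattice carpetMeasure,
      ZeroModulus X (univ : Set (RectifiableCurve carpet)) ∧
      newtonSpace X = X.functions ∧
      ∀ u ∈ X.functions, newtonNorm X u = X.norm u) ∧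
    (¬ PropertyA (LInfty carpetMeasure) ∧
      ¬ PropertyB (LInfty carpetMeasure) ∧
      ¬ PropertyC (LInfty carpetMeasure) ∧
      ¬ PropertyD (LInfty carpetMeasure) ∧
      ¬ PropertyE (LInfty carpetMeasure) ∧
      ¬ PropertyF (LInfty carpetMeasure) ∧
      ¬ PropertyG (LInfty carpetMeasure)) ∧
    ∃ K : Set carpet, IsCompact K ∧ interior K = ∅ ∧ 0 < carpetMeasure K ∧
      K.indicator (fun _ => (1 : EReal)) ∈ newtonSpace (LInfty carpetMeasure) ∧
      ¬ WeaklyQuasicontinuous (LInfty carpetMeasure) (K.indicator (fun _ => (1 : EReal))) := by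
  refine ⟨isProbabilityMeasure_carpetMeasure, fun x r hr => carpetMeasure_ball_pos x hr,
    map_carpetMeasure_mutuallySingular 0,
    fun X => ⟨zeroModulus_univ X, newtonSpace_eq X, fun u _ => newtonNorm_eq X u⟩,
    ⟨not_propertyA, not_propertyB, not_propertyC, not_propertyD, not_propertyE, not_propertyF,
      not_propertyG⟩, ?_⟩
  obtain ⟨K, hK, hKi, hKm⟩ := exists_compact_interior_eq_empty
  refine ⟨K, hK, hKi, hKm, ?_, not_weaklyQuasicontinuous_indicator hK.isClosed hKi hKm.ne'⟩
  rw [newtonSpace_eq]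
  exact indicator_one_mem_functions hK.measurableSet
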